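/- Let $G$ be a countable discrete group that is not amenable. Let $G$ act on $\{0,1\}^G$ (with the product topology) by left translations, $(gx)(h)=x(g^{-1}h)$. Let $H=\ell^2(G)$ (complex), let $\pi$ be the left regular representation of $G$ on $H$, $(\pi(g)f)(h)=f(g^{-1}h)$, and let $G$ act on the algebra $\mathcal B(H)$ of bounded operators by $\rho(g)T=\pi(g)\,T\,\pi(g)^{-1}$. Each $x\in\{0,1\}^G$ is regarded as an element of $\mathcal B(H)$, namely the operator of multiplication by $x$. A system $(Y,G)$ (an action of $G$ by homeomorphisms on a compact metrizable space $Y$) is called *minimal* if every orbit is dense. It is called *strongly proximal* if the induced action on the space $M(Y)$ of Borel probability measures with the weak$^*$ topology is proximal: for all $\mu,\nu\in M(Y)$ there are a net $(g_i)$ in $G$ and $\kappa\in M(Y)$ with $\lim g_i\mu=\lim g_i\nu=\kappa$. It is called *hereditarily almost equicontinuous* (HAE) if in every closed invariant subset $Z\subset Y$ the points of equicontinuity of $(Z,G)$ are dense in $Z$. Then there is an infinite closed invariant set $X\subset\{0,1\}^G$ with the following properties. 1. The system $(X,G)$ is minimal and strongly proximal, and it is not HAE. 2. $X$, considered as a subset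 of $\mathcal B(H)$, is not separable in the operator norm. 3. The closure $Q$ of the convex hull of $X$ in the weak operator topology of $\mathcal B(H)$ is $\rho(G)$-invariant and, with the weak operator topology, is a strongly proximal affine $G$-system (that is, $Q$ is nonempty, compact and convex, $G$ acts on it by continuous affine maps, and the system $(Q,G)$ is strongly proximal), and $Q$ contains no point fixed by $G$. -/

import Mathlib

open Filter Topology MeasureTheory

noncomputable section

/-! ### Amenability of a discrete group -/

/-- A left-invariant finitely additive probability measure defined on all subsets of `G`. -/
structure IsInvariantMean (G : Type*) [Group G] (m : Set G → ℝ) : Prop where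
  nonneg : ∀ A, 0 ≤ m A
  univ_eq_one : m Set.univ = 1
  add : ∀ A B, Disjoint A B → m (A ∪ B) = m A + m B
  invariant : ∀ (g : G) (A : Set G), m ((fun h => g * h) '' A) = m A

/-- Amenability of a discrete group (von Neumann's definition). -/
def IsAmenableGroup (G : Type*) [Group G] : Prop :=
  ∃ m : Set G → ℝ, IsInvariantMean G m

/-! ### Topological dynamics -/

/-- A family of self-maps of `X` indexed by `G` is proximal if for any two points there is a net
`gᵢ` in `G` along which the images of both points converge to one common point. (A net in `G` is
expressed by a proper filter on `G`.) -/
def IsProximal {G X : Type*} [TopologicalSpace X] (act : G → X → X) : Prop :=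
  ∀ x y : X, ∃ (z : X) (F : Filter G), F.NeBot ∧
    Tendsto (fun g => act g x) F (𝓝 z) ∧ Tendsto (fun g => act g y) F (𝓝 z)

/-- A system `(X, G)` is strongly proximal if the induced action (by push-forward) on the space of
Borel probability measures on `X`, with its weak-* topology, is proximal.
This is meant for compact metrizable `X`, where every Borel probability measure is regular. -/
def IsStronglyProximal (G X : Type*) [Group G] [TopologicalSpace X] [MulAction G X]
    [ContinuousConstSMul G X] : Prop :=
  letI : MeasurableSpace X := borel X
  haveI : BorelSpace X := ⟨rfl⟩
  IsProximal (fun (g : G) (μ : ProbabilityMeasure X) =>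
    μ.map (f := fun x : X => g • x) (continuous_const_smul g).measurable.aemeasurable)

/-- The set of equicontinuity points of a system `(X, G)`. On a compact metric space the
uniformity is the one given by the metric. -/
def equicontinuityPoints (G X : Type*) [Group G] [UniformSpace X] [MulAction G X] : Set X :=
  {x | EquicontinuousAt (fun (g : G) (y : X) => g • y) x}

/-- A system is hereditarily almost equicontinuous (HAE) if in each of its subsystems (closed
invariant subsets) the equicontinuity points are dense. -/
def IsHAE (G X : Type*) [Group G] [UniformSpace X] [MulAction G X] : Prop :=
  ∀ Y : SubMulAction G X, IsClosed (Y : Set X) → Dense (equicontinuityPoints G Y)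

/-- An affine `G`-system in a real topological vector space `E` on which `G` acts: a nonempty,
compact, convex and invariant set `Q` on which every `g ∈ G` acts as a continuous affine map. -/
structure IsAffineSystem (G : Type*) {E : Type*} [Group G] [AddCommGroup E] [Module ℝ E]
    [TopologicalSpace E] [MulAction G E] (Q : Set E) : Prop where
  nonempty : Q.Nonempty
  isCompact : IsCompact Q
  convex : Convex ℝ Q
  smul_mem : ∀ (g : G), ∀ x ∈ Q, g • x ∈ Q
  continuousOn : ∀ g : G, ContinuousOn (fun x => g • x) Q
  affine : ∀ (g : G), ∀ x ∈ Q, ∀ y ∈ Q, ∀ a b : ℝ, 0 ≤ a → 0 ≤ b → a + b = 1 →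
    g • (a • x + b • y) = a • (g • x) + b • (g • y)

instance SubMulAction.continuousConstSMul_coe {G E : Type*} [Group G] [TopologicalSpace E]
    [MulAction G E] [ContinuousConstSMul G E] (X : SubMulAction G E) :
    ContinuousConstSMul G X where
  continuous_const_smul g :=
    ((continuous_const_smul g).comp continuous_subtype_val).subtype_mk _

/-! ### The shift on `{0,1}^G` -/

/-- `G` acts on `{0,1}^G` by left translations, `(g • x) h = x (g⁻¹ h)`. -/
instance shiftAction (G : Type*) [Group G] : MulAction G (G → Bool) where
  smul g x := fun h => x (g⁻¹ * h)
  one_smul x := by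
    funext h
    change x (1⁻¹ * h) = x h
    simp
  mul_smul g k x := by
    funext h
    change x ((g * k)⁻¹ * h) = x (k⁻¹ * (g⁻¹ * h))
    simp [mul_assoc]

instance shift_continuousConstSMul (G : Type*) [Group G] :
    ContinuousConstSMul G (G → Bool) where
  continuous_const_smul g := continuous_pi fun h => continuous_apply (g⁻¹ * h)

/-! ### Operators on `ℓ²(G)` -/

/-- The Hilbert space `ℓ²(G)`. -/
abbrev Ell2 (G : Type*) : Type _ := lp (fun _ : G => ℂ) 2

/-- Translation by `g` on `ℓ²(G)`: `(koopmanFun g f) h = f (g⁻¹ h)`. -/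
def koopmanFun {G : Type*} [Group G] (g : G) (f : Ell2 G) : Ell2 G :=
  ⟨fun h => f (g⁻¹ * h), by
    have hf := (lp.memℓp f).summable (by norm_num)
    refine memℓp_gen ?_
    exact (Equiv.mulLeft g⁻¹).summable_iff.mpr hf⟩

theorem koopmanFun_apply {G : Type*} [Group G] (g : G) (f : Ell2 G) (h : G) :
    koopmanFun g f h = f (g⁻¹ * h) := rfl

theorem norm_koopmanFun {G : Type*} [Group G] (g : G) (f : Ell2 G) :
    ‖koopmanFun g f‖ = ‖f‖ := by
  rw [lp.norm_eq_tsum_rpow (by norm_num), lp.norm_eq_tsum_rpow (by norm_num)]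
  congr 1
  exact (Equiv.mulLeft g⁻¹).tsum_eq (fun h => ‖f h‖ ^ (2 : ENNReal).toReal)

/-- The Koopman (left regular) unitary representation `π` of `G` on `ℓ²(G)`. -/
def koopman (G : Type*) [Group G] : G →* (Ell2 G ≃ₗᵢ[ℂ] Ell2 G) where
  toFun g :=
    { toFun := koopmanFun g
      invFun := koopmanFun g⁻¹
      map_add' := fun _ _ => rfl
      map_smul' := fun _ _ => rfl
      left_inv := fun f => by
        apply lp.ext
        funext h
        simp [koopmanFun_apply]
      right_inv := fun f => by
        apply lp.ext
        funext h
        simp [koopmanFun_apply]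
      norm_map' := norm_koopmanFun g }
  map_one' := by
    ext f h
    change f (1⁻¹ * h) = f h
    simp
  map_mul' g k := by
    ext f h
    change f ((g * k)⁻¹ * h) = f (k⁻¹ * (g⁻¹ * h))
    simp [mul_assoc]

/-- `B(H)`, `H = ℓ²(G)`, with the weak operator topology. -/
abbrev OpWOT (G : Type*) : Type _ := Ell2 G →WOT[ℂ] Ell2 G

/-- The conjugation action `ρ` of `G` on `B(H)`: `ρ(g) T = π(g) ∘ T ∘ π(g)⁻¹`. -/
instance conjAction (G : Type*) [Group G] : MulAction G (OpWOT G) where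
  smul g T := ContinuousLinearMapWOT.ofCLM
    (((koopman G g : Ell2 G ≃L[ℂ] Ell2 G) : Ell2 G →L[ℂ] Ell2 G) ∘L T.toCLM ∘L
      (((koopman G g)⁻¹ : Ell2 G ≃ₗᵢ[ℂ] Ell2 G) : Ell2 G ≃L[ℂ] Ell2 G))
  one_smul T := by
    apply ContinuousLinearMapWOT.ext
    intro f
    change koopman G 1 (T ((koopman G 1)⁻¹ f)) = T f
    simp
  mul_smul g k T := by
    apply ContinuousLinearMapWOT.ext
    intro f
    change koopman G (g * k) (T ((koopman G (g * k))⁻¹ f)) =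
      koopman G g (koopman G k (T ((koopman G k)⁻¹ ((koopman G g)⁻¹ f))))
    simp

theorem conjAction_apply {G : Type*} [Group G] (g : G) (T : OpWOT G) (f : Ell2 G) :
    (g • T) f = koopman G g (T ((koopman G g)⁻¹ f)) := rfl

instance conj_continuousConstSMul (G : Type*) [Group G] :
    ContinuousConstSMul G (OpWOT G) where
  continuous_const_smul g := by
    refine ContinuousLinearMapWOT.continuous_of_dual_apply_continuous fun f y => ?_
    exact ContinuousLinearMapWOT.continuous_dual_apply ((koopman G g)⁻¹ f)
      (y ∘L ((koopman G g : Ell2 G ≃L[ℂ] Ell2 G) : Ell2 G →L[ℂ] Ell2 G))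

/-- The function `x : G → {0,1}` as a multiplication operator on `ℓ²(G)`:
`(mulOp x f) h = x(h) f(h)`. -/
def mulOp {G : Type*} (x : G → Bool) : Ell2 G →L[ℂ] Ell2 G :=
  LinearMap.mkContinuous
    { toFun := fun f => (⟨fun h => (if x h then 1 else 0 : ℂ) * f h, by
        refine (lp.memℓp f).mono' fun h => ?_
        by_cases hx : x h <;> simp [hx]⟩ : Ell2 G)
      map_add' := fun f f' => by
        apply lp.ext
        funext h
        exact mul_add _ _ _
      map_smul' := fun c f => by
        apply lp.ext
        funext h
        exact mul_left_comm _ _ _ }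
    1 (fun f => by
      rw [one_mul]
      refine lp.norm_mono (by norm_num) fun h => ?_
      by_cases hx : x h <;> simp [hx])

end

/-! ### Milman's theorem. -/

section Convexity

variable {E : Type*} [AddCommGroup E] [Module ℝ E] [TopologicalSpace E]

/-! Everything follows from one point `x ∈ {0,1}^G`, not constant, such that every point of the
closed convex hull `S` of its orbit has `x` in its orbit closure
(`exists_mem_closure_orbit_of_not_amenable`). To find it, take an irreducible affine subsystem of
the means on `G`; non-amenability leaves it without fixed points. For an extreme point `y` of it,
some `h ↦ y (h • A)` is not constant; cut it at a level `t` that it crosses but never attains. The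
resulting `x` depends continuously on `y` at `y` itself, so the orbit closure of `(x, y)` has the
single point `x` over `y`. Milman's theorem extends this to the closed convex hull of that orbit and
also puts `y` in every orbit closure of the irreducible system; together these give the property of
`x` (`IsIrreducibleAffine.mem_closure_orbit_of_fiber`).

Strong proximality of both systems: move the barycentre of `(μ + ν)/2` to `x`; since `x` is an
extreme point of the cube, both measures are forced to a Dirac mass
(`isStronglyProximal_of_mem_closure_orbit`). A fixed point of `S` would equal `x`, which is not
fixed; averaging then shows that the orbit closure `X` of `x` is infinite. An infinite minimal
subshift has no isolated points, hence no equicontinuity points, and is uncountable, while its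
points are at mutual norm distance at least 1. Diagonal operators identify `S` with `Q`. -/

theorem IsCompact.convexJoin [ContinuousAdd E] [ContinuousSMul ℝ E] {s t : Set E}
    (hs : IsCompact s) (ht : IsCompact t) : IsCompact (convexJoin ℝ s t) := by
  have h : _root_.convexJoin ℝ s t =
      (fun p : E × E × ℝ => (1 - p.2.2) • p.1 + p.2.2 • p.2.1) ''
        (s ×ˢ t ×ˢ Set.Icc (0 : ℝ) 1) := by
    ext z
    simp only [mem_convexJoin, segment_eq_image, Set.mem_image, Set.mem_prod, Prod.exists]
    constructor
    · rintro ⟨a, ha, b, hb, r, hr, rfl⟩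
      exact ⟨a, b, r, ⟨ha, hb, hr⟩, rfl⟩
    · rintro ⟨a, b, r, ⟨ha, hb, hr⟩, rfl⟩
      exact ⟨a, ha, b, hb, r, hr, rfl⟩
  rw [h]
  exact (hs.prod (ht.prod isCompact_Icc)).image (by fun_prop)

theorem isCompact_convexHull_union [ContinuousAdd E] [ContinuousSMul ℝ E] {s t : Set E}
    (hs : IsCompact (convexHull ℝ s)) (ht : IsCompact (convexHull ℝ t)) :
    IsCompact (convexHull ℝ (s ∪ t)) := by
  rcases s.eq_empty_or_nonempty with rfl | hs'
  · simpa using ht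
  rcases t.eq_empty_or_nonempty with rfl | ht'
  · simpa using hs
  rw [convexHull_union hs' ht']
  exact hs.convexJoin ht

theorem isCompact_convexHull_biUnion [ContinuousAdd E] [ContinuousSMul ℝ E] {ι : Type*}
    (I : Finset ι) {K : ι → Set E} (hK : ∀ i ∈ I, IsCompact (convexHull ℝ (K i))) :
    IsCompact (convexHull ℝ (⋃ i ∈ I, K i)) := by
  classical
  induction I using Finset.induction_on with
  | empty => simp
  | insert i I _ ih =>
    rw [Finset.set_biUnion_insert]
    exact isCompact_convexHull_union (hK i (by simp)) (ih fun j hj => hK j (by simp [hj]))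

/-- Milman's partial converse to the Krein-Milman theorem. -/
theorem extremePoints_closure_convexHull_subset [T2Space E] [IsTopologicalAddGroup E]
    [ContinuousSMul ℝ E] [LocallyConvexSpace ℝ E] {s : Set E}
    (hs : IsCompact (closure (convexHull ℝ s))) :
    (closure (convexHull ℝ s)).extremePoints ℝ ⊆ closure s := by
  intro y hy
  by_contra hys
  have hsub : closure s ⊆ closure (convexHull ℝ s) := closure_mono (subset_convexHull ℝ s)
  have hcs : IsCompact (closure s) := hs.of_isClosed_subset isClosed_closure hsub
  have hsep : ∀ b ∈ closure s, ∃ U : Set E, U ∈ 𝓝 b ∧ IsClosed U ∧ Convex ℝ U ∧ y ∉ U := by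
    intro b hb
    have hby : b ≠ y := fun h => hys (h ▸ hb)
    obtain ⟨l, hl⟩ := geometric_hahn_banach_point_point hby
    refine ⟨{z | l z ≤ (l b + l y) / 2}, ?_, isClosed_le l.continuous continuous_const,
      convex_halfSpace_le l.toLinearMap.isLinear _, ?_⟩
    · exact mem_of_superset ((isOpen_lt l.continuous continuous_const).mem_nhds
        (show l b < (l b + l y) / 2 by linarith)) fun z hz => le_of_lt (show l z < _ from hz)
    · simp only [Set.mem_ofPred_eq, not_le]
      linarith
  choose! U hU using hsep
  obtain ⟨I, hI, hcov⟩ := hcs.elim_nhds_subcover U fun b hb => (hU b hb).1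
  -- Finitely many compact convex pieces have a compact convex hull, which is therefore the whole
  -- closed hull. An extreme point of it must lie in one of the pieces, and all of them miss `y`.
  set K : E → Set E := fun b => closure (convexHull ℝ s) ∩ U b
  have hKconv : ∀ b ∈ I, Convex ℝ (K b) := fun b hb =>
    (convex_convexHull ℝ s).closure.inter (hU b (hI b hb)).2.2.1
  have hKc : IsCompact (convexHull ℝ (⋃ b ∈ I, K b)) :=
    isCompact_convexHull_biUnion I fun b hb => by
      rw [(hKconv b hb).convexHull_eq]
      exact hs.inter_right (hU b (hI b hb)).2.1
  have heq : convexHull ℝ (⋃ b ∈ I, K b) = closure (convexHull ℝ s) := by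
    apply Set.Subset.antisymm
    · exact convexHull_min (Set.iUnion₂_subset fun b _ => Set.inter_subset_left)
        (convex_convexHull ℝ s).closure
    · refine closure_minimal (convexHull_mono fun z hz => ?_) hKc.isClosed
      have hz' := subset_closure hz
      obtain ⟨b, hb, hzb⟩ := Set.mem_iUnion₂.1 (hcov hz')
      exact Set.mem_iUnion₂.2 ⟨b, hb, hsub hz', hzb⟩
  rw [← heq] at hy
  obtain ⟨b, hb, hyb⟩ := Set.mem_iUnion₂.1 (extremePoints_convexHull_subset hy)
  exact (hU b (hI b hb)).2.2.2 hyb.2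

end Convexity

/-! ### Irreducible affine systems and almost one-to-one extensions. -/

section AffineDynamics

theorem smul_mem_orbit_of_mem {G α : Type*} [Group G] [MulAction G α] {x : α} (g : G) : ∀ y ∈ MulAction.orbit G x,
    g • y ∈ MulAction.orbit G x := by
  rintro _ ⟨k, rfl⟩
  exact ⟨g * k, mul_smul g k x⟩

variable {G : Type*} [Group G]
variable {E : Type*} [AddCommGroup E] [Module ℝ E] [TopologicalSpace E] [DistribMulAction G E]

/-- A minimal nonempty compact convex invariant set. -/
structure IsIrreducibleAffine (G : Type*) {E : Type*} [Group G] [AddCommGroup E] [Module ℝ E]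
    [TopologicalSpace E] [DistribMulAction G E] (Q : Set E) : Prop where
  nonempty : Q.Nonempty
  isCompact : IsCompact Q
  convex : Convex ℝ Q
  smul_mem : ∀ (g : G), ∀ x ∈ Q, g • x ∈ Q
  subset : ∀ R ⊆ Q, R.Nonempty → IsClosed R → Convex ℝ R → (∀ (g : G), ∀ x ∈ R, g • x ∈ R) → Q ⊆ R

theorem exists_isIrreducibleAffine [T2Space E] {K : Set E} (hne : K.Nonempty) (hc : IsCompact K)
    (hconv : Convex ℝ K) (hinv : ∀ (g : G), ∀ x ∈ K, g • x ∈ K) :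
    ∃ Q ⊆ K, IsIrreducibleAffine G Q := by
  obtain ⟨Q, hQK, hQ⟩ := zorn_superset_nonempty
    {R : Set E | R.Nonempty ∧ IsCompact R ∧ Convex ℝ R ∧ ∀ (g : G), ∀ x ∈ R, g • x ∈ R}
    (by
      intro c hcS hchain hcne
      refine ⟨⋂₀ c, ⟨?_, ?_, ?_, ?_⟩, fun s hs => Set.sInter_subset_of_mem hs⟩
      · have : Nonempty c := hcne.to_subtype
        exact IsCompact.nonempty_sInter_of_directed_nonempty_isCompact_isClosed
          (fun s hs t ht => (hchain.total hs ht).elim (fun h => ⟨s, hs, subset_rfl, h⟩)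
            fun h => ⟨t, ht, h, subset_rfl⟩) (fun s hs => (hcS hs).1)
          (fun s hs => (hcS hs).2.1) (fun s hs => (hcS hs).2.1.isClosed)
      · obtain ⟨s, hs⟩ := hcne
        exact (hcS hs).2.1.of_isClosed_subset
          (isClosed_sInter fun t ht => (hcS ht).2.1.isClosed) (Set.sInter_subset_of_mem hs)
      · exact convex_sInter fun t ht => (hcS ht).2.2.1
      · exact fun g x hx t ht => (hcS ht).2.2.2 g x (hx t ht)) K ⟨hne, hc, hconv, hinv⟩
  refine ⟨Q, hQK, hQ.prop.1, hQ.prop.2.1, hQ.prop.2.2.1, hQ.prop.2.2.2, ?_⟩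
  intro R hRQ hRne hRc hRconv hRinv
  exact hQ.le_of_le ⟨hRne, hQ.prop.2.1.of_isClosed_subset hRc hRQ, hRconv, hRinv⟩ hRQ

variable [SMulCommClass G ℝ E] [ContinuousConstSMul G E]

theorem smul_mem_closure_convexHull {s : Set E} (hs : ∀ (g : G), ∀ x ∈ s, g • x ∈ s) (g : G) :
    ∀ x ∈ closure (convexHull ℝ s), g • x ∈ closure (convexHull ℝ s) := by
  have h : Set.MapsTo (fun x : E => g • x) (convexHull ℝ s) (convexHull ℝ s) := by
    intro x hx
    have : (DistribSMul.toLinearMap ℝ E g) x ∈ (DistribSMul.toLinearMap ℝ E g) '' convexHull ℝ s :=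
      Set.mem_image_of_mem _ hx
    rw [LinearMap.image_convexHull] at this
    refine convexHull_mono ?_ this
    rintro _ ⟨z, hz, rfl⟩
    exact hs g z hz
  exact fun x hx => h.closure (continuous_const_smul g) hx

variable [T2Space E] [IsTopologicalAddGroup E] [ContinuousSMul ℝ E]

theorem IsIrreducibleAffine.closure_convexHull_orbit {Q : Set E} (hQ : IsIrreducibleAffine G Q) {b : E}
    (hb : b ∈ Q) : closure (convexHull ℝ (MulAction.orbit G b)) = Q := by
  have hsub : closure (convexHull ℝ (MulAction.orbit G b)) ⊆ Q := by
    refine closure_minimal (convexHull_min ?_ hQ.convex) hQ.isCompact.isClosed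
    rintro _ ⟨g, rfl⟩
    exact hQ.smul_mem g b hb
  refine hsub.antisymm (hQ.subset _ hsub ?_ isClosed_closure (convex_convexHull ℝ _).closure ?_)
  · exact ⟨b, subset_closure (subset_convexHull ℝ _ (MulAction.mem_orbit_self b))⟩
  · exact smul_mem_closure_convexHull smul_mem_orbit_of_mem

variable [LocallyConvexSpace ℝ E]

/-- By irreducibility the closed convex hull of any orbit is all of `Q`, and Milman's theorem places
its extreme points in the orbit closure. -/
theorem IsIrreducibleAffine.mem_closure_orbit {Q : Set E} (hQ : IsIrreducibleAffine G Q) {b y : E}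
    (hb : b ∈ Q) (hy : y ∈ Q.extremePoints ℝ) : y ∈ closure (MulAction.orbit G b) := by
  have h := hQ.closure_convexHull_orbit hb
  apply extremePoints_closure_convexHull_subset (s := MulAction.orbit G b)
  · rw [h]
    exact hQ.isCompact
  · rwa [h]

variable {F : Type*} [AddCommGroup F] [Module ℝ F] [TopologicalSpace F] [DistribMulAction G F]
  [SMulCommClass G ℝ F] [ContinuousConstSMul G F]
  [T2Space F] [IsTopologicalAddGroup F] [ContinuousSMul ℝ F] [LocallyConvexSpace ℝ F]

/-- If the orbit closure of `(x, y)` is almost one-to-one over an extreme point `y` of an irreducible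
affine system, then every point of the closed convex hull of the orbit of `x` has `x` in its
orbit closure. -/
theorem IsIrreducibleAffine.mem_closure_orbit_of_fiber {Q : Set F} (hQ : IsIrreducibleAffine G Q)
    {y : F} (hy : y ∈ Q.extremePoints ℝ) {x : E}
    (hx : IsCompact (closure (convexHull ℝ (MulAction.orbit G x))))
    (hfib : ∀ x', (x', y) ∈ closure (MulAction.orbit G (x, y)) → x' = x) {a : E}
    (ha : a ∈ closure (convexHull ℝ (MulAction.orbit G x))) :
    x ∈ closure (MulAction.orbit G a) := by
  set C : Set (E × F) := closure (convexHull ℝ (MulAction.orbit G (x, y)))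
  have hCsub : C ⊆ closure (convexHull ℝ (MulAction.orbit G x)) ×ˢ Q := by
    refine closure_minimal (convexHull_min ?_ ?_) ?_
    · rintro _ ⟨g, rfl⟩
      exact ⟨subset_closure (subset_convexHull ℝ _ ⟨g, rfl⟩), hQ.smul_mem g y hy.1⟩
    · exact (convex_convexHull ℝ _).closure.prod hQ.convex
    · exact isClosed_closure.prod hQ.isCompact.isClosed
  have hC : IsCompact C := (hx.prod hQ.isCompact).of_isClosed_subset isClosed_closure hCsub
  have hCconv : Convex ℝ C := (convex_convexHull ℝ _).closure
  have hCinv : ∀ (g : G), ∀ z ∈ C, g • z ∈ C := smul_mem_closure_convexHull smul_mem_orbit_of_mem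
  have hCx : closure (convexHull ℝ (MulAction.orbit G x)) ⊆ Prod.fst '' C := by
    refine closure_minimal (convexHull_min ?_ (hCconv.linear_image (LinearMap.fst ℝ E F)))
      (hC.image continuous_fst).isClosed
    rintro _ ⟨g, rfl⟩
    exact ⟨g • (x, y), subset_closure (subset_convexHull ℝ _ ⟨g, rfl⟩), rfl⟩
  -- the fibre of `C` over `y` is a face with the only extreme point `(x, y)`
  set T : Set (E × F) := {z ∈ C | z.2 = y}
  have hT : IsCompact T := hC.inter_right (isClosed_eq continuous_snd continuous_const)
  have hTconv : Convex ℝ T := hCconv.inter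
    ((convex_singleton y).linear_preimage (LinearMap.snd ℝ E F))
  have hText : IsExtreme ℝ C T := by
    refine ⟨Set.sep_subset _ _, ?_⟩
    intro z₁ hz₁ z₂ hz₂ z hz hseg
    refine ⟨hz₁, ?_⟩
    refine hy.2 (hCsub hz₁).2 (hCsub hz₂).2 ?_
    obtain ⟨r, s, hr, hs, hrs, rfl⟩ := hseg
    exact ⟨r, s, hr, hs, hrs, hz.2⟩
  have hTsub : T ⊆ {(x, y)} := by
    rw [← closure_convexHull_extremePoints hT hTconv]
    refine closure_minimal (convexHull_min ?_ (convex_singleton _)) isClosed_singleton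
    rintro ⟨x', y'⟩ hz
    obtain rfl : y' = y := hz.1.2
    have := extremePoints_closure_convexHull_subset hC
      (hText.extremePoints_subset_extremePoints hz)
    rw [hfib x' this]
    rfl
  -- Lift `a` to `c ∈ C`. The orbit closure of `c` is compact and projects onto a set containing
  -- `y`, so it meets the fibre over `y`, which is only `(x, y)`.
  obtain ⟨c, hc, rfl⟩ := hCx ha
  have hOsub : closure (MulAction.orbit G c) ⊆ C := by
    refine closure_minimal ?_ isClosed_closure
    rintro _ ⟨g, rfl⟩
    exact hCinv g c hc
  have hO : IsCompact (closure (MulAction.orbit G c)) :=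
    hC.of_isClosed_subset isClosed_closure hOsub
  have hyO : y ∈ Prod.snd '' closure (MulAction.orbit G c) := by
    have h1 : closure (MulAction.orbit G c.2) ⊆ Prod.snd '' closure (MulAction.orbit G c) := by
      refine closure_minimal ?_ (hO.image continuous_snd).isClosed
      rintro _ ⟨g, rfl⟩
      exact ⟨g • c, subset_closure ⟨g, rfl⟩, rfl⟩
    exact h1 (hQ.mem_closure_orbit (hCsub hc).2 hy)
  obtain ⟨c', hc', hc'y⟩ := hyO
  obtain rfl : c' = (x, y) := hTsub ⟨hOsub hc', hc'y⟩
  have hm : Set.MapsTo Prod.fst (MulAction.orbit G c) (MulAction.orbit G c.1) := by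
    rintro _ ⟨g, rfl⟩
    exact ⟨g, rfl⟩
  exact hm.closure continuous_fst hc'

end AffineDynamics

/-! ### Thresholding an extreme mean. -/

section Translation

/-- Translation of real functions on a `G`-set. -/
instance translateAction (G ι : Type*) [Group G] [MulAction G ι] :
    DistribMulAction G (ι → ℝ) where
  smul g a := fun i => a (g⁻¹ • i)
  one_smul a := by
    funext i
    change a ((1 : G)⁻¹ • i) = a i
    simp
  mul_smul g k a := by
    funext i
    change a ((g * k)⁻¹ • i) = a (k⁻¹ • g⁻¹ • i)
    simp [mul_smul]
  smul_zero _ := rfl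
  smul_add _ _ _ := rfl

variable {G ι : Type*} [Group G] [MulAction G ι]

theorem translateAction_apply (g : G) (a : ι → ℝ) (i : ι) : (g • a) i = a (g⁻¹ • i) := rfl

instance translate_smulCommClass : SMulCommClass G ℝ (ι → ℝ) where
  smul_comm _ _ _ := rfl

instance translate_continuousConstSMul : ContinuousConstSMul G (ι → ℝ) where
  continuous_const_smul g := continuous_pi fun i => continuous_apply (g⁻¹ • i)

/-- A `{0,1}`-valued function as a real function. -/
def indicatorFun {ι : Type*} (x : ι → Bool) : ι → ℝ := fun i => if x i then 1 else 0

theorem smul_indicatorFun (g : G) (x : G → Bool) : g • indicatorFun x = indicatorFun (g • x) := rfl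

theorem continuous_indicatorFun : Continuous (indicatorFun : (ι → Bool) → ι → ℝ) :=
  continuous_pi fun i =>
    (continuous_of_discreteTopology (f := fun b : Bool => if b then (1 : ℝ) else 0)).comp
      (continuous_apply i)

theorem indicatorFun_injective : Function.Injective (indicatorFun : (ι → Bool) → ι → ℝ) := by
  intro x y h
  funext i
  have := congrFun h i
  cases hx : x i <;> cases hy : y i <;> simp [indicatorFun, hx, hy] at this ⊢

theorem indicatorFun_mem_Icc (x : ι → Bool) : indicatorFun x ∈ Set.Icc (0 : ι → ℝ) 1 := by
  constructor <;> intro i <;> by_cases h : x i <;> simp [indicatorFun, h]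

theorem isCompact_Icc_zero_one (ι : Type*) : IsCompact (Set.Icc (0 : ι → ℝ) 1) := by
  rw [← Set.pi_univ_Icc]
  exact isCompact_univ_pi fun _ => isCompact_Icc

theorem closure_convexHull_orbit_subset (x : G → Bool) :
    closure (convexHull ℝ (MulAction.orbit G (indicatorFun x))) ⊆ Set.Icc (0 : G → ℝ) 1 := by
  refine closure_minimal (convexHull_min ?_ (convex_Icc _ _)) isClosed_Icc
  rintro _ ⟨g, rfl⟩
  exact indicatorFun_mem_Icc (g • x)

open scoped Pointwise in
/-- For non-amenable `G` there is an irreducible affine system without fixed points consisting of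
finitely additive probability measures on `G`. -/
theorem exists_extremePoint_mean (G : Type*) [Group G] (hG : ¬ IsAmenableGroup G) :
    ∃ Q : Set (Set G → ℝ), IsIrreducibleAffine G Q ∧ ∀ y ∈ Q, ∃ (g : G) (A : Set G),
      y (g • A) ≠ y A := by
  set K : Set (Set G → ℝ) := {m | (∀ A, 0 ≤ m A) ∧ m Set.univ = 1 ∧
    ∀ A B, Disjoint A B → m (A ∪ B) = m A + m B}
  have hKsub : K ⊆ Set.Icc 0 1 := by
    rintro m ⟨h0, h1, h2⟩
    refine ⟨h0, fun A => ?_⟩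
    have := h2 A Aᶜ disjoint_compl_right
    rw [Set.union_compl_self, h1] at this
    have := h0 Aᶜ
    simp only [Pi.one_apply]
    linarith
  have hKclosed : IsClosed K := by
    simp only [K, Set.ofPred_and, Set.ofPred_forall]
    refine (isClosed_iInter fun A => isClosed_le continuous_const (continuous_apply A)).inter
      ((isClosed_eq (continuous_apply _) continuous_const).inter
        (isClosed_iInter fun A => isClosed_iInter fun B => isClosed_iInter fun _ =>
          isClosed_eq (by fun_prop) (by fun_prop)))
  have hKconv : Convex ℝ K := by
    rintro m ⟨h0, h1, h2⟩ m' ⟨h0', h1', h2'⟩ r s hr hs hrs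
    refine ⟨fun A => ?_, ?_, fun A B hAB => ?_⟩
    · simp only [Pi.add_apply, Pi.smul_apply, smul_eq_mul]
      have := mul_nonneg hr (h0 A)
      have := mul_nonneg hs (h0' A)
      linarith
    · simp [h1, h1', hrs]
    · simp only [Pi.add_apply, Pi.smul_apply, smul_eq_mul, h2 A B hAB, h2' A B hAB]
      ring
  have hKne : K.Nonempty := by
    classical
    -- The point mass at the identity is a mean.
    refine ⟨fun A => if (1 : G) ∈ A then 1 else 0, fun A => ?_, by simp, fun A B hAB => ?_⟩
    · dsimp only
      split_ifs <;> norm_num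
    · by_cases hA : (1 : G) ∈ A
      · simp [hA, Set.disjoint_left.1 hAB hA]
      · simp [hA]
  have hKinv : ∀ (g : G), ∀ m ∈ K, g • m ∈ K := by
    rintro g m ⟨h0, h1, h2⟩
    refine ⟨fun A => h0 _, ?_, fun A B hAB => ?_⟩
    · rw [translateAction_apply, Set.smul_set_univ, h1]
    · rw [translateAction_apply, translateAction_apply, translateAction_apply, Set.smul_set_union]
      exact h2 _ _ (by simpa using hAB)
  obtain ⟨Q, hQK, hQ⟩ := exists_isIrreducibleAffine (G := G) hKne
    ((isCompact_Icc_zero_one (Set G)).of_isClosed_subset hKclosed hKsub) hKconv hKinv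
  refine ⟨Q, hQ, fun y hy => ?_⟩
  by_contra! hcon
  exact hG ⟨y, (hQK hy).1, (hQK hy).2.1, (hQK hy).2.2, fun g A => hcon g A⟩

open scoped Pointwise in
/-- A non-amenable countable group has a non-constant `x ∈ {0,1}^G` that lies in the orbit closure
of every point of the closed convex hull of its orbit. -/
theorem exists_mem_closure_orbit_of_not_amenable (G : Type*) [Group G] [Countable G]
    (hG : ¬ IsAmenableGroup G) :
    ∃ x : G → Bool, (∃ h k, x h ≠ x k) ∧
      ∀ a ∈ closure (convexHull ℝ (MulAction.orbit G (indicatorFun x))),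
        indicatorFun x ∈ closure (MulAction.orbit G a) := by
  obtain ⟨Q, hQ, hfix⟩ := exists_extremePoint_mean G hG
  obtain ⟨y, hy⟩ := hQ.isCompact.extremePoints_nonempty hQ.nonempty
  obtain ⟨g, A, hgA⟩ := hfix y hy.1
  -- Countability of `G` makes the set of values null, while the open interval has positive length.
  obtain ⟨t, ht, htA⟩ : ∃ t ∈ Set.Ioo (min (y (g • A)) (y A)) (max (y (g • A)) (y A)),
      t ∉ Set.range (fun h : G => y (h • A)) := by
    by_contra! hcon
    refine (Set.countable_range fun h : G => y (h • A)).mono hcon |>.measure_zero volume |>.not_gt ?_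
    rw [Real.volume_Ioo, ENNReal.ofReal_pos, sub_pos]
    exact min_lt_max.2 hgA
  refine ⟨fun h => decide (t < y (h • A)), ⟨g, 1, ?_⟩, fun a ha => ?_⟩
  · rcases lt_or_gt_of_ne hgA with h | h
    · rw [min_eq_left h.le, max_eq_right h.le] at ht
      simp [ht.2, ht.1.le]
    · rw [min_eq_right h.le, max_eq_left h.le] at ht
      simp [ht.2, ht.1.le]
  refine hQ.mem_closure_orbit_of_fiber hy ((isCompact_Icc_zero_one G).of_isClosed_subset
    isClosed_closure (closure_convexHull_orbit_subset _)) (fun x' hx' => ?_) ha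
  funext h
  have hth : y (h • A) ≠ t := fun hh => htA ⟨h, hh⟩
  rcases lt_or_gt_of_ne hth with hlt | hgt
  -- The threshold rule, weakened to a closed condition, holds on the orbit and so passes to the
  -- limit. Over `y` the second alternative fails because `y (h • A)` is strictly on one side of
  -- `t`.
  · have hcl : IsClosed {p : (G → ℝ) × (Set G → ℝ) | p.1 h = 0 ∨ t ≤ p.2 (h • A)} :=
      (isClosed_eq ((continuous_apply h).comp continuous_fst) continuous_const).union
        (isClosed_le continuous_const ((continuous_apply (h • A)).comp continuous_snd))
    have := closure_minimal ?_ hcl hx'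
    · rcases this with h0 | h0
      · simpa [indicatorFun, not_lt.2 hlt.le] using h0
      · exact absurd h0 (not_le.2 hlt)
    rintro _ ⟨k, rfl⟩
    by_cases hk : t < y (k⁻¹ • h • A)
    · exact Or.inr hk.le
    · left
      simp [translateAction_apply, indicatorFun, mul_smul, not_lt.1 hk]
  · have hcl : IsClosed {p : (G → ℝ) × (Set G → ℝ) | p.1 h = 1 ∨ p.2 (h • A) ≤ t} :=
      (isClosed_eq ((continuous_apply h).comp continuous_fst) continuous_const).union
        (isClosed_le ((continuous_apply (h • A)).comp continuous_snd) continuous_const)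
    have := closure_minimal ?_ hcl hx'
    · rcases this with h0 | h0
      · simpa [indicatorFun, hgt] using h0
      · exact absurd h0 (not_le.2 hgt)
    rintro _ ⟨k, rfl⟩
    by_cases hk : t < y (k⁻¹ • h • A)
    · left
      simp [translateAction_apply, indicatorFun, mul_smul, hk]
    · exact Or.inr (not_lt.1 hk)

end Translation

/-! ### Barycentres and convergence to Dirac measures. -/

section Measures

/-- A point outside the closed set `K` is already separated from it by finitely many coordinates,
which reduces the claim to finite dimension. -/
theorem integral_mem_of_isCompact_convex {ι Y : Type*} [MeasurableSpace Y] (μ : Measure Y)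
    [IsProbabilityMeasure μ] {K : Set (ι → ℝ)} (hK : IsCompact K) (hconv : Convex ℝ K)
    {f : Y → ι → ℝ} (hf : ∀ y, f y ∈ K) (hint : ∀ i, Integrable (fun y => f y i) μ) :
    (fun i => ∫ y, f y i ∂μ) ∈ K := by
  by_contra hcon
  obtain ⟨I, u, hu, hsub⟩ := isOpen_pi_iff.1 hK.isClosed.isOpen_compl _ hcon
  let r : (ι → ℝ) →L[ℝ] (I → ℝ) := ContinuousLinearMap.pi fun i => ContinuousLinearMap.proj (i : ι)
  have hmem : ∫ y, r (f y) ∂μ ∈ r '' K :=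
    (hconv.linear_image r.toLinearMap).integral_mem (hK.image r.continuous).isClosed
      (ae_of_all _ fun y => Set.mem_image_of_mem _ (hf y))
      (Integrable.of_eval fun i => hint i)
  obtain ⟨k, hk, hkr⟩ := hmem
  refine hsub (fun i hi => ?_) hk
  have h1 : k i = (∫ y, r (f y) ∂μ) ⟨i, hi⟩ := congrFun hkr ⟨i, hi⟩
  rw [eval_integral (f := fun y => r (f y)) (fun i => hint i)] at h1
  rw [h1]
  exact (hu i hi).2

variable {Y ι : Type*} [TopologicalSpace Y] [CompactSpace Y]

/-- The coordinates of `θ` induce the topology of `Y`. Near `z` the term `ε` suffices; elsewhere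
some coordinate differs by at least `δ i`, and its summand exceeds the trivial bound `2 * ‖f‖`. -/
theorem exists_bound_of_coordinates {θ : Y → ι → ℝ} (hθ : Continuous θ)
    (hinj : Function.Injective θ) (z : Y) (f : BoundedContinuousFunction Y ℝ) {ε : ℝ}
    (hε : 0 < ε) :
    ∃ (I : Finset ι) (c : ι → ℝ), ∀ y, |f y - f z| ≤ ε + ∑ i ∈ I, c i * |θ y i - θ z i| := by
  have hU : {y | |f y - f z| < ε} ∈ 𝓝 z := by
    have : Tendsto f (𝓝 z) (𝓝 (f z)) := f.continuous.tendsto z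
    exact (Metric.tendsto_nhds.1 this ε hε).mono fun y hy => by rwa [Real.dist_eq] at hy
  rw [(hθ.isClosedEmbedding hinj).isInducing.nhds_eq_comap, mem_comap] at hU
  obtain ⟨V, hV, hVU⟩ := hU
  obtain ⟨W, hWV, hW, hzW⟩ := mem_nhds_iff.1 hV
  obtain ⟨I, u, hu, hsub⟩ := isOpen_pi_iff.1 hW _ hzW
  have hδ : ∀ i ∈ I, ∃ δ > 0, ∀ w, |w - θ z i| < δ → w ∈ u i := by
    intro i hi
    obtain ⟨δ, hδ, hball⟩ := Metric.isOpen_iff.1 (hu i hi).1 _ (hu i hi).2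
    exact ⟨δ, hδ, fun w hw => hball (by rwa [Metric.mem_ball, Real.dist_eq])⟩
  choose! δ hδ using hδ
  have hpos : ∀ y, ∀ i ∈ I, 0 ≤ 2 * ‖f‖ * (δ i)⁻¹ * |θ y i - θ z i| := fun y i hi => by
    have := (hδ i hi).1
    positivity
  refine ⟨I, fun i => 2 * ‖f‖ * (δ i)⁻¹, fun y => ?_⟩
  by_cases hy : ∀ i ∈ I, |θ y i - θ z i| < δ i
  · have : y ∈ {y | |f y - f z| < ε} := hVU (hWV (hsub fun i hi => (hδ i hi).2 _ (hy i hi)))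
    have h2 : |f y - f z| < ε := this
    have := Finset.sum_nonneg (hpos y)
    linarith
  · push Not at hy
    obtain ⟨i, hi, hiy⟩ := hy
    have h1 : |f y - f z| ≤ 2 * ‖f‖ := by
      rw [← Real.dist_eq]
      exact f.dist_le_two_norm y z
    have h2 : 2 * ‖f‖ * 1 ≤ 2 * ‖f‖ * ((δ i)⁻¹ * |θ y i - θ z i|) := by
      refine mul_le_mul_of_nonneg_left ?_ (by positivity)
      rw [inv_mul_eq_div, one_le_div (hδ i hi).1]
      exact hiy
    have h3 := Finset.single_le_sum (hpos y) hi
    linarith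

theorem tendsto_dirac_of_coordinates [MeasurableSpace Y] [BorelSpace Y] {θ : Y → ι → ℝ}
    (hθ : Continuous θ) (hinj : Function.Injective θ) (z : Y) {γ : Type*} {F : Filter γ}
    {μ : γ → ProbabilityMeasure Y}
    (h : ∀ i, Tendsto (fun g => ∫ y, |θ y i - θ z i| ∂(μ g : Measure Y)) F (𝓝 0)) :
    Tendsto μ F (𝓝 (diracProba z)) := by
  rw [ProbabilityMeasure.tendsto_iff_forall_integral_tendsto]
  intro f
  rw [diracProba, ProbabilityMeasure.coe_mk, integral_dirac' _ _ f.continuous.stronglyMeasurable,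
    Metric.tendsto_nhds]
  intro ε hε
  obtain ⟨I, c, hc⟩ := exists_bound_of_coordinates hθ hinj z f (half_pos hε)
  have hcont : ∀ i, Continuous fun y => |θ y i - θ z i| := fun i =>
    (((continuous_apply i).comp hθ).sub continuous_const).abs
  have hi : ∀ g i, Integrable (fun y => |θ y i - θ z i|) (μ g : Measure Y) := fun g i =>
    (hcont i).integrable_of_hasCompactSupport (HasCompactSupport.of_compactSpace _)
  have hlim : Tendsto (fun g => ε / 2 + ∑ i ∈ I, c i * ∫ y, |θ y i - θ z i| ∂(μ g : Measure Y)) F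
      (𝓝 (ε / 2 + ∑ i ∈ I, c i * 0)) :=
    tendsto_const_nhds.add (tendsto_finsetSum _ fun i _ => (h i).const_mul _)
  have hlt : ε / 2 + ∑ i ∈ I, c i * 0 < ε := by simpa using half_lt_self hε
  have hev := hlim.eventually_lt_const hlt
  refine hev.mono fun g hg => lt_of_le_of_lt ?_ hg
  have hfi : Integrable f (μ g : Measure Y) := f.integrable _
  have h1 : ∫ y, f y ∂(μ g : Measure Y) - f z = ∫ y, (f y - f z) ∂(μ g : Measure Y) := by
    rw [integral_sub hfi (integrable_const _)]
    simp
  rw [Real.dist_eq, h1]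
  refine abs_integral_le_integral_abs.trans ?_
  have hsum : Integrable (fun y => ∑ i ∈ I, c i * |θ y i - θ z i|) (μ g : Measure Y) :=
    integrable_finsetSum _ fun i _ => (hi g i).const_mul _
  calc ∫ y, |f y - f z| ∂(μ g : Measure Y)
      ≤ ∫ y, (ε / 2 + ∑ i ∈ I, c i * |θ y i - θ z i|) ∂(μ g : Measure Y) :=
        integral_mono (hfi.sub (integrable_const _)).abs ((integrable_const _).add hsum) hc
    _ = ε / 2 + ∑ i ∈ I, c i * ∫ y, |θ y i - θ z i| ∂(μ g : Measure Y) := by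
        rw [integral_add (integrable_const _) hsum,
          integral_finsetSum _ fun i _ => (hi g i).const_mul _]
        simp [integral_const_mul]

/-- A compact system which embeds equivariantly in a compact convex subset `K` of `[0,1]^ι` is
strongly proximal if some `{0,1}`-valued point of the system lies in the orbit closure of every point
of `K`. -/
theorem isStronglyProximal_of_mem_closure_orbit {G : Type*} [Group G] [MulAction G ι]
    [MulAction G Y] [ContinuousConstSMul G Y] {θ : Y → ι → ℝ} (hθ : Continuous θ)
    (hinj : Function.Injective θ) (hequiv : ∀ (g : G) y, θ (g • y) = g • θ y)
    {K : Set (ι → ℝ)} (hK : IsCompact K) (hconv : Convex ℝ K) (hK01 : K ⊆ Set.Icc 0 1)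
    (hθK : ∀ y, θ y ∈ K) {x : ι → Bool} {z : Y} (hz : θ z = indicatorFun x)
    (hx : ∀ a ∈ K, indicatorFun x ∈ closure (MulAction.orbit G a)) :
    IsStronglyProximal G Y := by
  let _ : MeasurableSpace Y := borel Y
  have : BorelSpace Y := ⟨rfl⟩
  have hcont : ∀ i, Continuous fun y => θ y i := fun i => (continuous_apply i).comp hθ
  have hint : ∀ (μ : ProbabilityMeasure Y) {f : Y → ℝ}, Continuous f →
      Integrable f (μ : Measure Y) := fun μ f hf =>
    hf.integrable_of_hasCompactSupport (HasCompactSupport.of_compactSpace _)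
  change IsProximal (fun (g : G) (μ : ProbabilityMeasure Y) =>
    μ.map (f := fun x : Y => g • x) (continuous_const_smul g).measurable.aemeasurable)
  intro μ ν
  -- Averaging the two barycentres lets one filter on `G` serve both measures.
  set a : ι → ℝ := (1 / 2 : ℝ) • (fun i => ∫ y, θ y i ∂(μ : Measure Y)) +
    (1 / 2 : ℝ) • (fun i => ∫ y, θ y i ∂(ν : Measure Y)) with ha
  have haK : a ∈ K := hconv
    (integral_mem_of_isCompact_convex (μ : Measure Y) hK hconv hθK fun i => hint μ (hcont i))
    (integral_mem_of_isCompact_convex (ν : Measure Y) hK hconv hθK fun i => hint ν (hcont i))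
    (by norm_num) (by norm_num) (by norm_num)
  set F : Filter G := comap (fun g : G => g • a) (𝓝 (indicatorFun x))
  have hF : F.NeBot := by
    refine comap_neBot_iff.2 fun t ht => ?_
    obtain ⟨_, hb, ⟨g, rfl⟩⟩ := mem_closure_iff_nhds.1 (hx a haK) t ht
    exact ⟨g, hb⟩
  have hlim : ∀ i, Tendsto (fun g : G => (g • a) i) F (𝓝 (indicatorFun x i)) := fun i =>
    ((continuous_apply i).tendsto _).comp tendsto_comap
  -- As `indicatorFun x i` is an endpoint of `[0,1]`, the distance to it is affine there, so
  -- convergence of barycentres becomes convergence in mean.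
  have habs : ∀ i, ∃ s : ℝ, ∀ w, 0 ≤ w → w ≤ 1 →
      |w - indicatorFun x i| = s * (w - indicatorFun x i) := by
    intro i
    by_cases hi : x i
    · refine ⟨-1, fun w h0 h1 => ?_⟩
      rw [abs_of_nonpos (by simp [indicatorFun, hi, h1])]
      ring
    · refine ⟨1, fun w h0 h1 => ?_⟩
      rw [abs_of_nonneg (by simp [indicatorFun, hi, h0])]
      ring
  have hmap : ∀ (κ : ProbabilityMeasure Y) (g : G) (i : ι),
      ∫ y, |θ y i - θ z i| ∂(κ.map (f := fun x : Y => g • x)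
        (continuous_const_smul g).measurable.aemeasurable : Measure Y) =
      ∫ y, |θ y (g⁻¹ • i) - indicatorFun x i| ∂(κ : Measure Y) := by
    intro κ g i
    rw [ProbabilityMeasure.toMeasure_map, integral_map (f := fun y => |θ y i - θ z i|)
      (continuous_const_smul g).measurable.aemeasurable
      ((hcont i).sub continuous_const).abs.aestronglyMeasurable]
    simp only [hequiv, translateAction_apply, hz]
  have hzero : ∀ i, Tendsto (fun g : G =>
      ∫ y, |θ y (g⁻¹ • i) - indicatorFun x i| ∂(μ : Measure Y) +
        ∫ y, |θ y (g⁻¹ • i) - indicatorFun x i| ∂(ν : Measure Y)) F (𝓝 0) := by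
    intro i
    obtain ⟨s, hs⟩ := habs i
    -- The factor 2 undoes the weights `1 / 2` in `a`.
    have h1 : Tendsto (fun g : G => 2 * (s * ((g • a) i - indicatorFun x i))) F (𝓝 0) := by
      simpa using (((hlim i).sub_const (indicatorFun x i)).const_mul s).const_mul 2
    refine h1.congr fun g => ?_
    have h2 : ∀ κ : ProbabilityMeasure Y,
        ∫ y, |θ y (g⁻¹ • i) - indicatorFun x i| ∂(κ : Measure Y) =
          s * (∫ y, θ y (g⁻¹ • i) ∂(κ : Measure Y) - indicatorFun x i) := by
      intro κ
      simp_rw [fun y => hs (θ y (g⁻¹ • i)) ((hK01 (hθK y)).1 _) ((hK01 (hθK y)).2 _)]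
      rw [integral_const_mul, integral_sub (hint κ (hcont _)) (integrable_const _)]
      simp
    rw [h2, h2, translateAction_apply, ha]
    simp only [Pi.add_apply, Pi.smul_apply, smul_eq_mul]
    ring
  have hnn : ∀ (κ : ProbabilityMeasure Y) (g : G) (i : ι),
      0 ≤ ∫ y, |θ y (g⁻¹ • i) - indicatorFun x i| ∂(κ : Measure Y) := fun κ g i =>
    integral_nonneg fun y => abs_nonneg _
  refine ⟨diracProba z, F, hF, tendsto_dirac_of_coordinates hθ hinj z fun i => ?_,
    tendsto_dirac_of_coordinates hθ hinj z fun i => ?_⟩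
  · simp_rw [hmap]
    exact squeeze_zero (fun g => hnn μ g i) (fun g => le_add_of_nonneg_right (hnn ν g i)) (hzero i)
  · simp_rw [hmap]
    exact squeeze_zero (fun g => hnn ν g i) (fun g => le_add_of_nonneg_left (hnn μ g i)) (hzero i)

end Measures

/-! ### Minimal systems and isolated points. -/

section OrbitClosure

variable {G : Type*} [Group G]

/-- The orbit closure of a point as a subsystem. -/
def orbitClosure (G : Type*) {α : Type*} [Group G] [TopologicalSpace α] [MulAction G α]
    [ContinuousConstSMul G α] (x : α) : SubMulAction G α where
  carrier := closure (MulAction.orbit G x)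
  smul_mem' g y hy := by
    have h : Set.MapsTo (fun z : α => g • z) (MulAction.orbit G x) (MulAction.orbit G x) :=
      smul_mem_orbit_of_mem g
    exact h.closure (continuous_const_smul g) hy

theorem isMinimal_orbitClosure {α : Type*} [TopologicalSpace α] [MulAction G α]
    [ContinuousConstSMul G α] {x : α}
    (h : ∀ y ∈ orbitClosure G x, x ∈ closure (MulAction.orbit G y)) :
    MulAction.IsMinimal G (orbitClosure G x) where
  dense_orbit y := by
    have h1 : (Subtype.val '' MulAction.orbit G y : Set α) = MulAction.orbit G (y : α) := by
      ext z
      constructor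
      · rintro ⟨_, ⟨g, rfl⟩, rfl⟩
        exact ⟨g, rfl⟩
      · rintro ⟨g, rfl⟩
        exact ⟨g • y, ⟨g, rfl⟩, rfl⟩
    refine Subtype.dense_iff.2 (Set.Subset.trans ?_ (congrArg closure h1).ge)
    refine closure_minimal ?_ isClosed_closure
    rintro _ ⟨g, rfl⟩
    exact (orbitClosure G (y : α)).smul_mem g (h y y.2)

/-- By minimality and compactness, finitely many translates of the open singleton cover `Y`. -/
theorem finite_of_isMinimal_of_isOpen_singleton {Y : Type*} [TopologicalSpace Y] [CompactSpace Y]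
    [MulAction G Y] [ContinuousConstSMul G Y] [MulAction.IsMinimal G Y] {y : Y}
    (hy : IsOpen {y}) : Finite Y := by
  obtain ⟨I, hI⟩ := isCompact_univ.exists_finite_cover_smul G hy (Set.singleton_nonempty y)
  refine Set.finite_univ_iff.1 (Set.Finite.subset ?_ hI)
  exact I.finite_toSet.biUnion fun g _ => by
    rw [Set.smul_set_singleton]
    exact Set.finite_singleton _

/-- By Baire, a countable compact Hausdorff space has an isolated point. -/
theorem not_countable_of_isMinimal {Y : Type*} [TopologicalSpace Y] [CompactSpace Y] [T2Space Y]
    [MulAction G Y] [ContinuousConstSMul G Y] [MulAction.IsMinimal G Y] [Infinite Y] :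
    ¬ Countable Y := by
  intro hcount
  obtain ⟨y, hy⟩ := nonempty_interior_of_iUnion_of_closed (f := fun y : Y => ({y} : Set Y))
    (fun y => isClosed_singleton) (by ext; simp)
  have hopen : IsOpen ({y} : Set Y) := by
    rw [← interior_eq_iff_isOpen]
    exact (Set.subset_singleton_iff_eq.1 interior_subset).resolve_left hy.ne_empty
  exact not_finite_iff_infinite.2 ‹_› (finite_of_isMinimal_of_isOpen_singleton (G := G) hopen)

end OrbitClosure

/-! ### Properties of the orbit closure of `x`. -/

section Subshift

variable {G : Type*} [Group G]

theorem eq_of_forall_smul_apply_one {x y : G → Bool} (h : ∀ g : G, (g • x) 1 = (g • y) 1) :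
    x = y := by
  funext k
  have := h k⁻¹
  change x (k⁻¹⁻¹ * 1) = y (k⁻¹⁻¹ * 1) at this
  simpa using this

/-- Subshifts are expansive: the coordinate at `1`, read along all translates, determines a point.
An equicontinuity point is therefore isolated. -/
theorem not_isHAE_of_isMinimal (X : SubMulAction G (G → Bool)) (hX : IsClosed (X : Set (G → Bool)))
    [MulAction.IsMinimal G X] [Infinite X] : ¬ IsHAE G X := by
  intro hHAE
  have : CompactSpace X := isCompact_iff_compactSpace.1 hX.isCompact
  have hdense := hHAE ⊤ isClosed_univ
  have hne : Nonempty (⊤ : SubMulAction G X) :=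
    ⟨⟨Classical.arbitrary X, trivial⟩⟩
  obtain ⟨p, hp⟩ := hdense.nonempty
  have huc : UniformContinuous fun q : (⊤ : SubMulAction G X) => (q : X).1 1 :=
    (Pi.uniformContinuous_proj _ (1 : G)).comp
      (uniformContinuous_subtype_val.comp uniformContinuous_subtype_val)
  have hU : {q : (⊤ : SubMulAction G X) × (⊤ : SubMulAction G X) |
      (q.1 : X).1 1 = (q.2 : X).1 1} ∈ uniformity (⊤ : SubMulAction G X) := by
    have h1 : (SetRel.id : SetRel Bool Bool) ∈ uniformity Bool := by
      rw [DiscreteUniformity.eq_principal_setRelId Bool]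
      exact mem_principal_self _
    exact huc h1
  have hev := hp _ hU
  have hsub : {p} ∈ 𝓝 p := by
    refine mem_of_superset hev fun q hq => ?_
    have : (p : X).1 = (q : X).1 := eq_of_forall_smul_apply_one hq
    exact (Subtype.ext (Subtype.ext this)).symm
  have hopen : IsOpen ({p} : Set (⊤ : SubMulAction G X)) := isOpen_singleton_iff_nhds_eq_pure p |>.2
    (le_antisymm (le_pure_iff.2 hsub) (pure_le_nhds p))
  have hopen' : IsOpen ({(p : X)} : Set X) := by
    have := (isOpen_univ : IsOpen ((⊤ : SubMulAction G X) : Set X)).isOpenMap_subtype_val _ hopen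
    rwa [Set.image_singleton] at this
  exact not_finite_iff_infinite.2 ‹_› (finite_of_isMinimal_of_isOpen_singleton (G := G) hopen')

theorem indicatorFun_mem_closure_convexHull {x y : G → Bool} (hy : y ∈ orbitClosure G x) :
    indicatorFun y ∈ closure (convexHull ℝ (MulAction.orbit G (indicatorFun x))) := by
  have h : Set.MapsTo indicatorFun (MulAction.orbit G x)
      (convexHull ℝ (MulAction.orbit G (indicatorFun x))) := by
    rintro _ ⟨g, rfl⟩
    exact subset_convexHull ℝ _ ⟨g, rfl⟩
  exact h.closure continuous_indicatorFun hy

theorem mem_closure_orbit_of_indicatorFun {x y : G → Bool}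
    (h : indicatorFun x ∈ closure (MulAction.orbit G (indicatorFun y))) :
    x ∈ closure (MulAction.orbit G y) := by
  rw [(continuous_indicatorFun.isClosedEmbedding
    indicatorFun_injective).isInducing.closure_eq_preimage_closure_image]
  refine closure_mono ?_ h
  rintro _ ⟨g, rfl⟩
  exact ⟨g • y, ⟨g, rfl⟩, rfl⟩

theorem exists_smul_ne {x : G → Bool} (hx : ∃ h k, x h ≠ x k) : ∃ g : G, g • x ≠ x := by
  obtain ⟨h, k, hhk⟩ := hx
  by_contra! hcon
  have h1 : ∀ g, x g = x 1 := by
    intro g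
    have := congrFun (hcon g⁻¹) 1
    change x (g⁻¹⁻¹ * 1) = x 1 at this
    simpa using this
  exact hhk ((h1 h).trans (h1 k).symm)

/-- A fixed point in the closed convex hull of the orbit of `x` is impossible when `x` is not fixed
and lies in the orbit closure of every point of the hull. -/
theorem not_forall_smul_eq {x : G → Bool} (hx : ∃ h k, x h ≠ x k) {a : G → ℝ}
    (ha : indicatorFun x ∈ closure (MulAction.orbit G a)) : ¬ ∀ g : G, g • a = a := by
  intro hfix
  have horb : MulAction.orbit G a ⊆ {a} := by
    rintro _ ⟨g, rfl⟩
    exact hfix g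
  have hxa : indicatorFun x = a := closure_minimal horb isClosed_singleton ha
  obtain ⟨g, hg⟩ := exists_smul_ne hx
  apply hg
  apply indicatorFun_injective
  rw [← smul_indicatorFun, hxa, hfix g]

/-- The average over a finite orbit closure would be a fixed point in the closed hull. -/
theorem infinite_orbitClosure {x : G → Bool} (hx : ∃ h k, x h ≠ x k)
    (hkey : ∀ a ∈ closure (convexHull ℝ (MulAction.orbit G (indicatorFun x))),
      indicatorFun x ∈ closure (MulAction.orbit G a)) :
    Infinite (orbitClosure G x) := by
  by_contra hfin
  have : Finite (orbitClosure G x) := not_infinite_iff_finite.1 hfin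
  have := Fintype.ofFinite (orbitClosure G x)
  have : Nonempty (orbitClosure G x) := ⟨⟨x, subset_closure (MulAction.mem_orbit_self x)⟩⟩
  set n : ℝ := (Fintype.card (orbitClosure G x) : ℝ)
  have hn : n ≠ 0 := Nat.cast_ne_zero.2 Fintype.card_ne_zero
  refine not_forall_smul_eq hx (hkey (∑ y : orbitClosure G x, n⁻¹ • indicatorFun y.1) ?_) ?_
  · refine (convex_convexHull ℝ _).closure.sum_mem (fun _ _ => by positivity) ?_
      fun y _ => indicatorFun_mem_closure_convexHull y.2
    rw [Finset.sum_const, Finset.card_univ, nsmul_eq_mul]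
    exact mul_inv_cancel₀ hn
  · intro g
    rw [Finset.smul_sum]
    refine Eq.trans ?_ (Equiv.sum_comp (MulAction.toPerm g)
      fun y : orbitClosure G x => n⁻¹ • indicatorFun y.1)
    rfl

end Subshift

/-! ### Diagonal operators in the norm and weak operator topologies. -/

section MultiplicationOperators

variable {G : Type*}

theorem mulOp_apply (x : G → Bool) (f : Ell2 G) (h : G) :
    mulOp x f h = (if x h then 1 else 0 : ℂ) * f h := rfl

/-- Test on the unit vector at a coordinate where `x` and `y` differ. -/
theorem one_le_dist_mulOp {x y : G → Bool} (hxy : x ≠ y) : 1 ≤ dist (mulOp x) (mulOp y) := by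
  classical
  obtain ⟨h, hh⟩ := Function.ne_iff.1 hxy
  set e : Ell2 G := lp.single 2 h (1 : ℂ)
  have he : ‖e‖ = 1 := by
    rw [lp.norm_single (by norm_num), norm_one]
  have h1 : ‖(mulOp x - mulOp y) e‖ ≤ ‖mulOp x - mulOp y‖ := by
    simpa [he] using (mulOp x - mulOp y).le_opNorm e
  have h2 : ‖((mulOp x - mulOp y) e) h‖ ≤ ‖(mulOp x - mulOp y) e‖ :=
    lp.norm_apply_le_norm (by norm_num) _ h
  have h3 : ‖((mulOp x - mulOp y) e) h‖ = 1 := by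
    change ‖mulOp x e h - mulOp y e h‖ = 1
    rw [mulOp_apply, mulOp_apply, lp.single_apply_self]
    cases hx : x h <;> cases hy : y h <;> simp [hx, hy] at hh ⊢
  rw [dist_eq_norm]
  linarith

theorem countable_of_isSeparable_mulOp {X : Set (G → Bool)}
    (hX : TopologicalSpace.IsSeparable (mulOp '' X)) : X.Countable := by
  have hsep := hX.separableSpace
  have hdisc : DiscreteTopology (mulOp '' X) := by
    refine DiscreteTopology.of_forall_le_dist one_pos ?_
    rintro ⟨_, x, hx, rfl⟩ ⟨_, y, hy, rfl⟩ hxy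
    exact one_le_dist_mulOp fun h => hxy (by simp [h])
  have hcount : Countable (mulOp '' X) :=
    TopologicalSpace.separableSpace_iff_countable.1 hsep
  refine Set.countable_of_injective_of_countable_image (f := mulOp) ?_ hcount
  intro x _ y _ hxy
  by_contra hne
  have := one_le_dist_mulOp hne
  rw [hxy, dist_self] at this
  linarith

/-- The multiplication operator on `ℓ²(G)` by a real function truncated to `[0,1]`. -/
noncomputable def clampMulOp (a : G → ℝ) : Ell2 G →L[ℂ] Ell2 G :=
  LinearMap.mkContinuous
    { toFun := fun f => (⟨fun h => ((max 0 (min 1 (a h)) : ℝ) : ℂ) * f h, by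
        refine (lp.memℓp f).mono' fun h => ?_
        rw [norm_mul, Complex.norm_real, Real.norm_of_nonneg (le_max_left _ _)]
        exact mul_le_of_le_one_left (norm_nonneg _) (by simp)⟩ : Ell2 G)
      map_add' := fun f f' => by
        apply lp.ext
        funext h
        exact mul_add _ _ _
      map_smul' := fun c f => by
        apply lp.ext
        funext h
        exact mul_left_comm _ _ _ }
    1 (fun f => by
      rw [one_mul]
      refine lp.norm_mono (by norm_num) fun h => ?_
      change ‖((max 0 (min 1 (a h)) : ℝ) : ℂ) * f h‖ ≤ ‖f h‖
      rw [norm_mul, Complex.norm_real, Real.norm_of_nonneg (le_max_left _ _)]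
      exact mul_le_of_le_one_left (norm_nonneg _) (by simp))

theorem clampMulOp_apply (a : G → ℝ) (f : Ell2 G) (h : G) :
    clampMulOp a f h = ((max 0 (min 1 (a h)) : ℝ) : ℂ) * f h := rfl

theorem clampMulOp_apply_of_mem {a : G → ℝ} (ha : a ∈ Set.Icc (0 : G → ℝ) 1) (f : Ell2 G) (h : G) :
    clampMulOp a f h = (a h : ℂ) * f h := by
  have h0 : 0 ≤ a h := ha.1 h
  have h1 : a h ≤ 1 := ha.2 h
  rw [clampMulOp_apply, min_eq_right h1, max_eq_right h0]

theorem clampMulOp_indicatorFun (x : G → Bool) : clampMulOp (indicatorFun x) = mulOp x := by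
  ext f h
  rw [clampMulOp_apply_of_mem (indicatorFun_mem_Icc x), mulOp_apply]
  by_cases hx : x h <;> simp [indicatorFun, hx]

/-- Each matrix coefficient is a series of continuous terms; the truncation gives a summable bound
independent of `a`. -/
theorem continuous_ofCLM_clampMulOp :
    Continuous fun a : G → ℝ => (ContinuousLinearMapWOT.ofCLM (clampMulOp a) : OpWOT G) := by
  rw [ContinuousLinearMapWOT.continuous_iff]
  intro f u
  simp only [ContinuousLinearMapWOT.ofCLM_apply, lp.inner_eq_tsum, clampMulOp_apply]
  refine continuous_tsum (u := fun h => ‖u h‖ * ‖f h‖) (fun h => ?_) ?_ fun h a => ?_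
  · have : Continuous fun a : G → ℝ => ((max 0 (min 1 (a h)) : ℝ) : ℂ) :=
      Complex.continuous_ofReal.comp
        (continuous_const.max (continuous_const.min (continuous_apply h)))
    exact continuous_const.inner (this.mul continuous_const)
  · exact lp.summable_mul (by rw [Real.holderConjugate_iff]; norm_num) u f
  · refine (norm_inner_le_norm _ _).trans (mul_le_mul_of_nonneg_left ?_ (norm_nonneg _))
    rw [norm_mul, Complex.norm_real, Real.norm_of_nonneg (le_max_left _ _)]
    exact mul_le_of_le_one_left (norm_nonneg _) (by simp)

open Classical in
/-- The real part of the diagonal of an operator on `ℓ²(G)`. -/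
noncomputable def diagonalRe (T : OpWOT G) : G → ℝ := fun h => (T (lp.single 2 h (1 : ℂ)) h).re

theorem continuous_diagonalRe : Continuous (diagonalRe : OpWOT G → G → ℝ) := by
  classical
  refine continuous_pi fun h => Complex.continuous_re.comp ?_
  have h1 : Continuous fun T : OpWOT G =>
      inner ℂ (lp.single 2 h (1 : ℂ) : Ell2 G) (T (lp.single 2 h (1 : ℂ))) :=
    ContinuousLinearMapWOT.continuous_iff.1 continuous_id _ _
  refine h1.congr fun T => ?_
  rw [lp.inner_single_left]
  simp

theorem diagonalRe_clampMulOp {a : G → ℝ} (ha : a ∈ Set.Icc (0 : G → ℝ) 1) :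
    diagonalRe (ContinuousLinearMapWOT.ofCLM (clampMulOp a) : OpWOT G) = a := by
  classical
  funext h
  rw [diagonalRe, ContinuousLinearMapWOT.ofCLM_apply, clampMulOp_apply_of_mem ha,
    lp.single_apply_self]
  simp

theorem ofCLM_clampMulOp_add_smul {a b : G → ℝ} (ha : a ∈ Set.Icc (0 : G → ℝ) 1)
    (hb : b ∈ Set.Icc (0 : G → ℝ) 1) {r s : ℝ} (hr : 0 ≤ r) (hs : 0 ≤ s) (hrs : r + s = 1) :
    (ContinuousLinearMapWOT.ofCLM (clampMulOp (r • a + s • b)) : OpWOT G) =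
      r • (ContinuousLinearMapWOT.ofCLM (clampMulOp a) : OpWOT G) +
        s • (ContinuousLinearMapWOT.ofCLM (clampMulOp b) : OpWOT G) := by
  apply ContinuousLinearMapWOT.ext
  intro f
  apply lp.ext
  funext h
  change clampMulOp (r • a + s • b) f h = (r : ℂ) * clampMulOp a f h + (s : ℂ) * clampMulOp b f h
  rw [clampMulOp_apply_of_mem (convex_Icc _ _ ha hb hr hs hrs), clampMulOp_apply_of_mem ha,
    clampMulOp_apply_of_mem hb]
  simp only [Pi.add_apply, Pi.smul_apply, smul_eq_mul, Complex.ofReal_add, Complex.ofReal_mul]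
  ring

theorem convex_image_clampMulOp {S : Set (G → ℝ)} (hS : Convex ℝ S) (hS01 : S ⊆ Set.Icc 0 1) :
    Convex ℝ ((fun a => (ContinuousLinearMapWOT.ofCLM (clampMulOp a) : OpWOT G)) '' S) := by
  rintro _ ⟨a, ha, rfl⟩ _ ⟨b, hb, rfl⟩ r s hr hs hrs
  exact ⟨r • a + s • b, hS ha hb hr hs hrs,
    ofCLM_clampMulOp_add_smul (hS01 ha) (hS01 hb) hr hs hrs⟩

variable [Group G]

theorem koopman_inv_apply (g : G) (f : Ell2 G) (h : G) : ((koopman G g)⁻¹ f) h = f (g * h) := by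
  rw [← map_inv]
  change f (g⁻¹⁻¹ * h) = f (g * h)
  rw [inv_inv]

theorem ofCLM_clampMulOp_smul (g : G) (a : G → ℝ) :
    (ContinuousLinearMapWOT.ofCLM (clampMulOp (g • a)) : OpWOT G) =
      g • (ContinuousLinearMapWOT.ofCLM (clampMulOp a) : OpWOT G) := by
  apply ContinuousLinearMapWOT.ext
  intro f
  rw [conjAction_apply]
  apply lp.ext
  funext h
  change clampMulOp (g • a) f h = clampMulOp a ((koopman G g)⁻¹ f) (g⁻¹ * h)
  rw [clampMulOp_apply, clampMulOp_apply, koopman_inv_apply, mul_inv_cancel_left]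
  rfl

theorem conjAction_add_smul (g : G) (S T : OpWOT G) (r s : ℝ) :
    g • (r • S + s • T) = r • (g • S) + s • (g • T) := by
  apply ContinuousLinearMapWOT.ext
  intro f
  apply lp.ext
  funext h
  rfl

/-- One inclusion uses that the map is continuous, and affine on the cube; the other that the image
of a compact convex subset of the cube is compact, hence closed, and convex. -/
theorem image_clampMulOp_closure_convexHull (x : G → Bool) :
    (fun a => (ContinuousLinearMapWOT.ofCLM (clampMulOp a) : OpWOT G)) ''
        closure (convexHull ℝ (MulAction.orbit G (indicatorFun x))) =
      closure (convexHull ℝ ((fun x => (ContinuousLinearMapWOT.ofCLM (mulOp x) : OpWOT G)) ''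
        (orbitClosure G x : Set (G → Bool)))) := by
  have hsub := closure_convexHull_orbit_subset x
  apply Set.Subset.antisymm
  · have hconv : Convex ℝ {a ∈ Set.Icc (0 : G → ℝ) 1 |
        (ContinuousLinearMapWOT.ofCLM (clampMulOp a) : OpWOT G) ∈
          convexHull ℝ ((fun x => (ContinuousLinearMapWOT.ofCLM (mulOp x) : OpWOT G)) ''
            (orbitClosure G x : Set (G → Bool)))} := by
      rintro a ⟨ha, ha'⟩ b ⟨hb, hb'⟩ r s hr hs hrs
      refine ⟨convex_Icc _ _ ha hb hr hs hrs, ?_⟩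
      rw [ofCLM_clampMulOp_add_smul ha hb hr hs hrs]
      exact convex_convexHull ℝ _ ha' hb' hr hs hrs
    have hmaps : Set.MapsTo (fun a => (ContinuousLinearMapWOT.ofCLM (clampMulOp a) : OpWOT G))
        (convexHull ℝ (MulAction.orbit G (indicatorFun x)))
        (convexHull ℝ ((fun x => (ContinuousLinearMapWOT.ofCLM (mulOp x) : OpWOT G)) ''
          (orbitClosure G x : Set (G → Bool)))) := by
      intro a ha
      refine (convexHull_min ?_ hconv ha).2
      rintro _ ⟨g, rfl⟩
      refine ⟨indicatorFun_mem_Icc (g • x), subset_convexHull ℝ _ ⟨g • x, ?_, ?_⟩⟩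
      · exact subset_closure ⟨g, rfl⟩
      · simp only [smul_indicatorFun, clampMulOp_indicatorFun]
    exact (hmaps.closure continuous_ofCLM_clampMulOp).image_subset
  · refine closure_minimal (convexHull_min ?_
      (convex_image_clampMulOp (convex_convexHull ℝ _).closure hsub)) ?_
    · rintro _ ⟨y, hy, rfl⟩
      exact ⟨indicatorFun y, indicatorFun_mem_closure_convexHull hy, by
        simp only [clampMulOp_indicatorFun]⟩
    · exact (((isCompact_Icc_zero_one G).of_isClosed_subset isClosed_closure hsub).image
        continuous_ofCLM_clampMulOp).isClosed

end MultiplicationOperators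

/-! ### Assembly of the theorem. -/

theorem theorem2p3 (G : Type*) [Group G] [Countable G] (hG : ¬ IsAmenableGroup G) :
    ∃ X : SubMulAction G (G → Bool),
      IsClosed (X : Set (G → Bool)) ∧ (X : Set (G → Bool)).Infinite ∧
      (MulAction.IsMinimal G X ∧ IsStronglyProximal G X ∧ ¬ IsHAE G X) ∧
      -- `mulOp` takes values in `B(H)` with the operator norm
      ¬ TopologicalSpace.IsSeparable (mulOp '' (X : Set (G → Bool))) ∧
      -- in the weak operator topology
      ∃ Q : SubMulAction G (OpWOT G),
        (Q : Set (OpWOT G)) =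
          closure (convexHull ℝ
            ((fun x => ContinuousLinearMapWOT.ofCLM (mulOp x)) '' (X : Set (G → Bool)))) ∧
        IsAffineSystem G (Q : Set (OpWOT G)) ∧
        IsStronglyProximal G Q ∧
        ¬ ∃ T ∈ Q, ∀ g : G, g • T = T := by
  obtain ⟨x, hx, hkey⟩ := exists_mem_closure_orbit_of_not_amenable G hG
  set S : Set (G → ℝ) := closure (convexHull ℝ (MulAction.orbit G (indicatorFun x)))
  have hS01 : S ⊆ Set.Icc 0 1 := closure_convexHull_orbit_subset x
  have hScpt : IsCompact S := (isCompact_Icc_zero_one G).of_isClosed_subset isClosed_closure hS01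
  have hSconv : Convex ℝ S := (convex_convexHull ℝ _).closure
  have hSinv : ∀ (g : G), ∀ a ∈ S, g • a ∈ S := smul_mem_closure_convexHull smul_mem_orbit_of_mem
  have hxX : x ∈ orbitClosure G x := subset_closure (MulAction.mem_orbit_self x)
  have hXclosed : IsClosed (orbitClosure G x : Set (G → Bool)) := isClosed_closure
  have hXcpt : CompactSpace (orbitClosure G x) := isCompact_iff_compactSpace.1 hXclosed.isCompact
  have hmin : MulAction.IsMinimal G (orbitClosure G x) := isMinimal_orbitClosure fun y hy =>
    mem_closure_orbit_of_indicatorFun (hkey _ (indicatorFun_mem_closure_convexHull hy))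
  have hinf : Infinite (orbitClosure G x) := infinite_orbitClosure hx hkey
  let D : (G → ℝ) → OpWOT G := fun a => ContinuousLinearMapWOT.ofCLM (clampMulOp a)
  let Q : SubMulAction G (OpWOT G) :=
    { carrier := D '' S
      smul_mem' := by
        rintro g _ ⟨a, ha, rfl⟩
        exact ⟨g • a, hSinv g a ha, ofCLM_clampMulOp_smul g a⟩ }
  have hQcpt : IsCompact (Q : Set (OpWOT G)) := hScpt.image continuous_ofCLM_clampMulOp
  have hxS : indicatorFun x ∈ S := indicatorFun_mem_closure_convexHull hxX
  refine ⟨orbitClosure G x, hXclosed, Set.infinite_coe_iff.1 hinf, ⟨hmin, ?_, ?_⟩, ?_, Q,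
    image_clampMulOp_closure_convexHull x, ?_, ?_, ?_⟩
  · exact isStronglyProximal_of_mem_closure_orbit (θ := fun y : orbitClosure G x => indicatorFun y.1)
      (continuous_indicatorFun.comp continuous_subtype_val)
      (indicatorFun_injective.comp Subtype.val_injective) (fun _ _ => rfl) hScpt hSconv hS01
      (fun y => indicatorFun_mem_closure_convexHull y.2) (z := ⟨x, hxX⟩) rfl hkey
  · exact not_isHAE_of_isMinimal _ hXclosed
  · intro hsep
    exact not_countable_of_isMinimal (G := G) (Y := orbitClosure G x)
      (countable_of_isSeparable_mulOp hsep).to_subtype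
  · exact
      { nonempty := ⟨D (indicatorFun x), indicatorFun x, hxS, rfl⟩
        isCompact := hQcpt
        convex := convex_image_clampMulOp hSconv hS01
        smul_mem := fun g T hT => Q.smul_mem g hT
        continuousOn := fun g => (continuous_const_smul g).continuousOn
        affine := fun g T _ T' _ r s _ _ _ => conjAction_add_smul g T T' r s }
  · have : CompactSpace Q := isCompact_iff_compactSpace.1 hQcpt
    -- On `D '' S` the diagonal inverts `D`, so `Q` embeds equivariantly in the same `S` and `hkey`
    -- applies again.
    refine isStronglyProximal_of_mem_closure_orbit (θ := fun T : Q => diagonalRe T.1)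
      (continuous_diagonalRe.comp continuous_subtype_val) ?_ ?_ hScpt hSconv hS01 ?_
      (z := ⟨D (indicatorFun x), indicatorFun x, hxS, rfl⟩)
      (diagonalRe_clampMulOp (indicatorFun_mem_Icc x)) hkey
    · rintro ⟨_, a, ha, rfl⟩ ⟨_, b, hb, rfl⟩ hab
      have hab' : diagonalRe (D a) = diagonalRe (D b) := hab
      rw [diagonalRe_clampMulOp (hS01 ha), diagonalRe_clampMulOp (hS01 hb)] at hab'
      subst hab'
      rfl
    · rintro g ⟨_, a, ha, rfl⟩
      change diagonalRe (g • D a) = g • diagonalRe (D a)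
      rw [← ofCLM_clampMulOp_smul, diagonalRe_clampMulOp (hS01 (hSinv g a ha)),
        diagonalRe_clampMulOp (hS01 ha)]
    · rintro ⟨_, a, ha, rfl⟩
      change diagonalRe (D a) ∈ S
      rwa [diagonalRe_clampMulOp (hS01 ha)]
  · rintro ⟨_, ⟨a, ha, rfl⟩, hfix⟩
    refine not_forall_smul_eq hx (hkey a ha) fun g => ?_
    have h1 : D (g • a) = D a := (ofCLM_clampMulOp_smul g a).trans (hfix g)
    exact (diagonalRe_clampMulOp (hS01 (hSinv g a ha))).symm.trans
      ((congrArg diagonalRe h1).trans (diagonalRe_clampMulOp (hS01 ha)))
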